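/- **Model.** A seller sets prices $p_t\in[0,\bar p]$ in rounds $t=1,\dots,T$. At price $p$ and reference price $r$ the expected demand is $$D(p,r)=b-ap+\eta^+(r-p)^+-\eta^-(p-r)^+ ,$$ where $a>0$, $\eta^+,\eta^-\ge 0$ and $0<\frac{b}{2a}<\bar p$ (the maximizer of $p(b-ap)$ lies in the interior of the price range). If the reference price at time $t_1\in\{1,\dots,T\}$ is $r\in[0,\bar p]$ and prices $\mathbf p=(p_s)_{s\ge t_1}$ are charged, then the reference price at time $t\ge t_1$ is $$r_t=\frac{t_1 r+\sum_{s=t_1}^{t-1}p_s}{t}.$$ Write $V^{\mathbf p}(r,t_1)=\sum_{t=t_1}^T p_t D(p_t,r_t)$, let $V^*(r,t_1)$ be the supremum of $V^{\mathbf p}(r,t_1)$ over all $\mathbf p\in[0,\bar p]^{\{t_1,\dots,T\}}$, and abbreviate $V^{\mathbf p}(r)=V^{\mathbf p}(r,1)$, $V^*(r)=V^*(r,1)$. There is an absolute constant $K>0$ such that (1) and (2) hold. **(1)** There are functions $t^\dagger$ and $p^\dagger$ of $(T,\bar p,a,b,\eta^+,r)$ (not of $\eta^-$) such that, for every $T\ge1$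 and all parameters as above, the following holds. For $r\in[0,\bar p]$ we have $t^\dagger\in\{1,\dots,T\}$ and $p^\dagger\in[0,\bar p]$, and the price curve $\tilde{\mathbf p}(r)=(p_t)_{t=1}^T$ given by $$p_t=\begin{cases}\bar p, & 1\le t\le t^\dagger-1,\\ p^\dagger, & t=t^\dagger,\\ p_{t-1}-\dfrac{\eta^+r_{t-1}}{2(a+\eta^+)t+\eta^+}, & t^\dagger+1\le t\le T-1,\\[2mm] \dfrac{\eta^+r_T+b}{2(a+\eta^+)}, & t=T,\end{cases}\qquad r_t=\frac{r+\sum_{s=1}^{t-1}p_s}{t},$$ is consistent (if $t^\dagger=T$, then the second and the fourth line agree) and has all its prices in $[0,\bar p]$. Moreover: * if $\eta^+=\eta^-$, then $V^*(r)=V^{\tilde{\mathbf p}(r)}(r)$ for every $r\in[0,\bar p]$; * for any $(\eta^+,\eta^-)$, if $T\ge 2$, then for every starting reference price $r\in[0,\bar p]$ the fixed price sequence $\tilde{\mathbf p}(\bar p)$ (computed from starting reference price $\bar p$) satisfies $$V^*(r)-V^{\tilde{\mathbf p}(\bar p)}(r)\le K\,\bar p(\bar p-r)(\eta^++\eta^-)\ln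 T=O(\ln T).$$ **(2)** There are functions $t^\dagger$ and $p^\dagger$ of $(T,\bar p,C_1,C_2,r,t_1)$ such that, for all $1\le t_1\le T$ and all parameters as above, with $C_1=\frac{\eta^+}{2(a+\eta^+)}$ and $C_2=\frac{b}{2(a+\eta^+)}$, the following holds. For $r\in[0,\bar p]$ we have $t^\dagger\in\{t_1,\dots,T\}$ and $p^\dagger\in[0,\bar p]$, and the price curve $\tilde{\mathbf p}(r,t_1)=(p_t)_{t=t_1}^T$ given by $$p_t=\begin{cases}\bar p, & t_1\le t\le t^\dagger-1,\\ p^\dagger, & t=t^\dagger,\\ p_{t-1}-\dfrac{C_1r_{t-1}}{t+C_1}, & t^\dagger+1\le t\le T-1,\\[2mm] C_1r_T+C_2, & t=T,\end{cases}\qquad r_t=\frac{t_1r+\sum_{s=t_1}^{t-1}p_s}{t},$$ is consistent in the same sense and has all its prices in $[0,\bar p]$. Moreover: * if $\eta^+=\eta^-$, then $V^*(r,t_1)=V^{\tilde{\mathbf p}(r,t_1)}(r,t_1)$ for every $r\in[0,\bar p]$; * for any $(\eta^+,\eta^-)$, if $t_1<T$, then for every $r\in[0,\bar p]$ $$V^*(r,t_1)-V^{\tilde{\mathbf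 p}(\bar p,t_1)}(r,t_1)\le K\,\bar p(\bar p-r)(\eta^++\eta^-)\,t_1\ln\frac{T}{t_1}=O\!\left(t_1\ln\frac{T}{t_1}\right).$$ -/

import Mathlib

open Finset

/-- The averaging reference mechanism: if the reference price is `r` at time `t₁` and the prices
`p t₁, p (t₁ + 1), …` are charged from then on, then the reference price at time `t ≥ t₁` is
`(t₁ r + ∑_{s = t₁}^{t - 1} p s) / t`. -/
noncomputable def refPrice (t₁ : ℕ) (r : ℝ) (p : ℕ → ℝ) (t : ℕ) : ℝ :=
  ((t₁ : ℝ) * r + ∑ s ∈ Ico t₁ t, p s) / (t : ℝ)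

/-- Expected demand at price `p` and reference price `r`, with base demand `H`, gain parameter
`ηp` and loss parameter `ηm`. -/
def demand (H : ℝ → ℝ) (ηp ηm p r : ℝ) : ℝ :=
  H p + ηp * max (r - p) 0 - ηm * max (p - r) 0

/-- Linear base demand `H(p) = b - a p`. -/
def linearBase (a b : ℝ) : ℝ → ℝ := fun p => b - a * p

/-- Expected cumulative revenue over the rounds `t₁, …, T` of the price sequence `p`, when the
reference price at time `t₁` is `r`. -/
noncomputable def revenue (H : ℝ → ℝ) (ηp ηm : ℝ) (T t₁ : ℕ) (r : ℝ) (p : ℕ → ℝ) : ℝ :=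
  ∑ t ∈ Icc t₁ T, p t * demand H ηp ηm (p t) (refPrice t₁ r p t)

/-- The price sequences that use only prices in `[0, pbar]` in the rounds `t₁, …, T`. -/
def feasiblePrices (pbar : ℝ) (T t₁ : ℕ) : Set (ℕ → ℝ) :=
  {p | ∀ t ∈ Icc t₁ T, p t ∈ Set.Icc 0 pbar}

/-- The optimal expected cumulative revenue from reference price `r` at time `t₁`. -/
noncomputable def optRevenue (H : ℝ → ℝ) (ηp ηm pbar : ℝ) (T t₁ : ℕ) (r : ℝ) : ℝ :=
  sSup (revenue H ηp ηm T t₁ r '' feasiblePrices pbar T t₁)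

/-- Problem instances with linear base demand for which the maximizer `b / (2a)` of `p (b - a p)`
is in the interior of the price range `[0, pbar]`. -/
structure IsInstance (pbar a b ηp ηm : ℝ) : Prop where
  a_pos : 0 < a
  gain_nonneg : 0 ≤ ηp
  loss_nonneg : 0 ≤ ηm
  maximizer_pos : 0 < b / (2 * a)
  maximizer_lt : b / (2 * a) < pbar

/-- The price curve that charges `pbar` before time `tDag`, charges `pDag` at time `tDag`, goes
from the price of round `t - 1` to that of round `t ∈ (tDag, T)` by subtracting `drop t r_{t-1}`,
and charges `final r_T` at time `T` (when `tDag < T`); here `r_t` is the reference price at time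
`t` under this very curve, started at reference price `r` at time `t₁`
(see `markdownCurve_eq`). -/
noncomputable def markdownCurve (drop : ℕ → ℝ → ℝ) (final : ℝ → ℝ) (pbar : ℝ) (T t₁ : ℕ) (r : ℝ)
    (tDag : ℕ) (pDag : ℝ) (t : ℕ) : ℝ :=
  if t < tDag then pbar
  else if _h : t = tDag then pDag
  else if t < T then
    markdownCurve drop final pbar T t₁ r tDag pDag (t - 1)
      - drop t (((t₁ : ℝ) * r + ∑ s ∈ (Ico t₁ (t - 1)).attach,
          markdownCurve drop final pbar T t₁ r tDag pDag s.1) / ((t - 1 : ℕ) : ℝ))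
  else
    final (((t₁ : ℝ) * r + ∑ s ∈ (Ico t₁ t).attach,
      markdownCurve drop final pbar T t₁ r tDag pDag s.1) / (t : ℝ))
termination_by t
decreasing_by
  · omega
  · have := (Finset.mem_Ico.1 s.2).2; omega
  · exact (Finset.mem_Ico.1 s.2).2

theorem markdownCurve_eq (drop : ℕ → ℝ → ℝ) (final : ℝ → ℝ) (pbar : ℝ) (T t₁ : ℕ) (r : ℝ)
    (tDag : ℕ) (pDag : ℝ) (t : ℕ) :
    markdownCurve drop final pbar T t₁ r tDag pDag t =
      if t < tDag then pbar
      else if t = tDag then pDag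
      else if t < T then
        markdownCurve drop final pbar T t₁ r tDag pDag (t - 1)
          - drop t (refPrice t₁ r (markdownCurve drop final pbar T t₁ r tDag pDag) (t - 1))
      else final (refPrice t₁ r (markdownCurve drop final pbar T t₁ r tDag pDag) t) := by
  rw [markdownCurve]
  simp only [refPrice, dite_eq_ite]
  rw [Finset.sum_attach (Ico t₁ (t - 1)) (markdownCurve drop final pbar T t₁ r tDag pDag),
    Finset.sum_attach (Ico t₁ t) (markdownCurve drop final pbar T t₁ r tDag pDag)]

/-- The curve of the original parametrization: starting time `1`, markdown
`ηp r_{t-1} / (2 (a + ηp) t + ηp)` and last price `(ηp r_T + b) / (2 (a + ηp))`. -/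
noncomputable def instanceCurve (a b ηp pbar : ℝ) (T : ℕ) (r : ℝ) (tDag : ℕ) (pDag : ℝ) : ℕ → ℝ :=
  markdownCurve (fun t x => ηp * x / (2 * (a + ηp) * (t : ℝ) + ηp))
    (fun x => (ηp * x + b) / (2 * (a + ηp))) pbar T 1 r tDag pDag

/-- The curve with policy parameter `(C₁, C₂)` and starting time `t₁`: markdown
`C₁ r_{t-1} / (t + C₁)` and last price `C₁ r_T + C₂`. -/
noncomputable def policyCurve (C₁ C₂ pbar : ℝ) (T t₁ : ℕ) (r : ℝ) (tDag : ℕ) (pDag : ℝ) : ℕ → ℝ :=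
  markdownCurve (fun t x => C₁ * x / ((t : ℝ) + C₁)) (fun x => C₁ * x + C₂) pbar T t₁ r tDag pDag

/-- The running-average form of the reference price dynamics. -/
theorem refPrice_succ (t₁ : ℕ) (r : ℝ) (p : ℕ → ℝ) (t : ℕ) (h₁ : 1 ≤ t₁) (h : t₁ ≤ t) :
    refPrice t₁ r p (t + 1) = ((t : ℝ) * refPrice t₁ r p t + p t) / ((t : ℝ) + 1) := by
  have ht : (t : ℝ) ≠ 0 := by
    have : t ≠ 0 := by omega
    exact_mod_cast this
  unfold refPrice
  rw [Finset.sum_Ico_succ_top h, mul_div_cancel₀ _ ht]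
  push_cast
  ring

theorem refPrice_self (t₁ : ℕ) (r : ℝ) (p : ℕ → ℝ) (h₁ : 1 ≤ t₁) : refPrice t₁ r p t₁ = r := by
  have ht : (t₁ : ℝ) ≠ 0 := by
    have : t₁ ≠ 0 := by omega
    exact_mod_cast this
  simp [refPrice, ht]

theorem refPrice_mem {pbar : ℝ} {T t₁ : ℕ} {r : ℝ} {p : ℕ → ℝ} (h₁ : 1 ≤ t₁)
    (hr : r ∈ Set.Icc 0 pbar) (hp : p ∈ feasiblePrices pbar T t₁) {t : ℕ} (ht : t ∈ Icc t₁ T) :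
    refPrice t₁ r p t ∈ Set.Icc 0 pbar := by
  have ht' := Finset.mem_Icc.1 ht
  have hp' : ∀ s ∈ Ico t₁ t, p s ∈ Set.Icc 0 pbar := fun s hs => by
    have hs' := Finset.mem_Ico.1 hs
    exact hp s (Finset.mem_Icc.2 ⟨hs'.1, by omega⟩)
  have hpos : (0 : ℝ) < (t : ℝ) := by
    have : 0 < t := by omega
    exact_mod_cast this
  constructor
  · exact div_nonneg (add_nonneg (mul_nonneg (Nat.cast_nonneg _) hr.1)
      (Finset.sum_nonneg fun s hs => (hp' s hs).1)) hpos.le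
  · rw [refPrice, div_le_iff₀ hpos]
    have h2 : ∑ s ∈ Ico t₁ t, p s ≤ ∑ _s ∈ Ico t₁ t, pbar :=
      Finset.sum_le_sum fun s hs => (hp' s hs).2
    rw [Finset.sum_const, Nat.card_Ico, nsmul_eq_mul, Nat.cast_sub ht'.1] at h2
    have h3 : (t₁ : ℝ) * r ≤ (t₁ : ℝ) * pbar := mul_le_mul_of_nonneg_left hr.2 (Nat.cast_nonneg _)
    nlinarith

/-- The supremum that defines `optRevenue` is that of a set of reals that is bounded above (and
contains the revenue of the zero price sequence). -/
theorem bddAbove_revenue {pbar a b ηp ηm : ℝ} (hI : IsInstance pbar a b ηp ηm) {T t₁ : ℕ}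
    (h₁ : 1 ≤ t₁) {r : ℝ} (hr : r ∈ Set.Icc 0 pbar) :
    BddAbove (revenue (linearBase a b) ηp ηm T t₁ r '' feasiblePrices pbar T t₁) := by
  refine ⟨∑ t ∈ Icc t₁ T, pbar * (|b| + ηp * pbar), ?_⟩
  rintro _ ⟨p, hp, rfl⟩
  refine Finset.sum_le_sum fun t ht => ?_
  have hpt := hp t ht
  have hrt := refPrice_mem h₁ hr hp ht
  have hpb : 0 ≤ pbar := hpt.1.trans hpt.2
  have hd : demand (linearBase a b) ηp ηm (p t) (refPrice t₁ r p t) ≤ |b| + ηp * pbar := by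
    have e1 : ηp * max (refPrice t₁ r p t - p t) 0 ≤ ηp * pbar :=
      mul_le_mul_of_nonneg_left (max_le (by linarith [hpt.1, hrt.2]) hpb) hI.gain_nonneg
    have e2 : 0 ≤ ηm * max (p t - refPrice t₁ r p t) 0 :=
      mul_nonneg hI.loss_nonneg (le_max_right _ _)
    have e3 : 0 ≤ a * p t := mul_nonneg hI.a_pos.le hpt.1
    have e4 := le_abs_self b
    unfold demand linearBase
    linarith
  have hn : 0 ≤ |b| + ηp * pbar := add_nonneg (abs_nonneg _) (mul_nonneg hI.gain_nonneg hpb)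
  exact (mul_le_mul_of_nonneg_left hd hpt.1).trans (mul_le_mul_of_nonneg_right hpt.2 hn)

/-! ### Revenue as a function of the price sequence -/

/-! If the gain and loss parameters agree, demand is linear in the reference price. The revenue is
then a quadratic form in the prices which, divided by `2 (a + η)`, depends only on `C₁`, `C₂`. By
compactness it has a maximizer `p`. In each single coordinate it is a concave parabola whose vertex
`q t` is `bestResponse`, so `p t = min pbar (q t)`. Consecutive vertices satisfy `(t + 1) (q (t + 1)
- q t) = C₁ (p t - r t - p (t + 1))` with `r t` the reference price (`bestResponse_succ`). The sign
of the right side shows that `p` is nonincreasing and that `q` stays below `pbar` once it is there.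
After that round `p = q`, and the identity becomes the markdown recursion. So every maximizer is a
policy curve (`exists_policyCurve_isMaxOn`).

For unequal parameters and starting reference price `pbar`, sorting the prices into nonincreasing
order costs no revenue (`exists_antitone_revenue_le`). Sorted prices never exceed the reference
price, so the loss parameter is irrelevant and may be replaced by `ηp`: the symmetric curve is
optimal. A lower start `r` only lowers the optimum, and it shifts the reference price at time `t` by
`t₁ (pbar - r) / t`. Summing these shifts gives the logarithmic regret of that curve. -/

theorem refPrice_congr {t₁ : ℕ} {r : ℝ} {p q : ℕ → ℝ} {t : ℕ}
    (h : ∀ s, t₁ ≤ s → s < t → p s = q s) : refPrice t₁ r p t = refPrice t₁ r q t := by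
  unfold refPrice
  rw [Finset.sum_congr rfl fun s hs => h s (Finset.mem_Ico.1 hs).1 (Finset.mem_Ico.1 hs).2]

theorem continuous_refPrice (t₁ : ℕ) (r : ℝ) (t : ℕ) :
    Continuous fun p : ℕ → ℝ => refPrice t₁ r p t := by
  unfold refPrice
  fun_prop

theorem revenue_congr {H : ℝ → ℝ} {ηp ηm : ℝ} {T t₁ : ℕ} {r : ℝ} {p q : ℕ → ℝ}
    (h : ∀ s ∈ Icc t₁ T, p s = q s) :
    revenue H ηp ηm T t₁ r p = revenue H ηp ηm T t₁ r q := by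
  refine Finset.sum_congr rfl fun t ht => ?_
  rw [h t ht, refPrice_congr fun s hs hst =>
    h s (Finset.mem_Icc.2 ⟨hs, hst.le.trans (Finset.mem_Icc.1 ht).2⟩)]

theorem continuous_revenue (a b ηp ηm : ℝ) (T t₁ : ℕ) (r : ℝ) :
    Continuous (revenue (linearBase a b) ηp ηm T t₁ r) := by
  have h := continuous_refPrice t₁ r
  unfold revenue demand linearBase
  fun_prop

/-- The price sequences that use only prices in `[0, pbar]`, in every round. -/
def priceBox (pbar : ℝ) : Set (ℕ → ℝ) := Set.univ.pi fun _ => Set.Icc 0 pbar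

theorem isCompact_priceBox (pbar : ℝ) : IsCompact (priceBox pbar) :=
  isCompact_univ_pi fun _ => isCompact_Icc

theorem priceBox_subset (pbar : ℝ) (T t₁ : ℕ) : priceBox pbar ⊆ feasiblePrices pbar T t₁ :=
  fun _ hp t _ => hp t trivial

/-- `feasiblePrices` leaves the rounds outside `[t₁, T]` free and so is not compact. Setting those
prices to `0`, which no revenue sees, moves optimization to the compact `priceBox`. -/
theorem exists_mem_priceBox_eqOn {pbar : ℝ} (hpb : 0 ≤ pbar) {T t₁ : ℕ} {p : ℕ → ℝ}
    (hp : p ∈ feasiblePrices pbar T t₁) : ∃ q ∈ priceBox pbar, ∀ s ∈ Icc t₁ T, p s = q s := by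
  classical
  refine ⟨fun t => if t ∈ Icc t₁ T then p t else 0, fun t _ => ?_, fun s hs => by simp only [if_pos hs]⟩
  dsimp only
  split_ifs with h
  · exact hp t h
  · exact ⟨le_rfl, hpb⟩

/-! ### The normalized symmetric revenue and its maximizers -/

/-- With symmetric reference effects the revenue is, up to the factor `2 (a + η)`, this function of
the policy parameter (see `revenue_symm`). -/
noncomputable def normalizedRevenue (C₁ C₂ : ℝ) (T t₁ : ℕ) (r : ℝ) (p : ℕ → ℝ) : ℝ :=
  ∑ t ∈ Icc t₁ T, p t * (C₂ - p t / 2 + C₁ * refPrice t₁ r p t)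

theorem demand_symm (H : ℝ → ℝ) (η p r : ℝ) : demand H η η p r = H p + η * (r - p) := by
  unfold demand
  rcases le_total p r with h | h
  · rw [max_eq_left (by linarith), max_eq_right (by linarith)]; ring
  · rw [max_eq_right (by linarith), max_eq_left (by linarith)]; ring

theorem revenue_symm {a η : ℝ} (b : ℝ) (h : 0 < a + η) (T t₁ : ℕ) (r : ℝ) (p : ℕ → ℝ) :
    revenue (linearBase a b) η η T t₁ r p =
      2 * (a + η) * normalizedRevenue (η / (2 * (a + η))) (b / (2 * (a + η))) T t₁ r p := by
  unfold revenue normalizedRevenue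
  rw [Finset.mul_sum]
  refine Finset.sum_congr rfl fun t _ => ?_
  rw [demand_symm, linearBase]
  field_simp
  ring

/-- The unconstrained best price of round `t` when the other prices are held fixed. -/
noncomputable def bestResponse (C₁ C₂ : ℝ) (T t₁ : ℕ) (r : ℝ) (p : ℕ → ℝ) (t : ℕ) : ℝ :=
  C₂ + C₁ * (refPrice t₁ r p t + ∑ s ∈ Ioc t T, p s / s)

theorem refPrice_update {t₁ : ℕ} (r : ℝ) (p : ℕ → ℝ) {t : ℕ} (ht : t₁ ≤ t) (x : ℝ) (s : ℕ) :
    refPrice t₁ r (Function.update p t x) s =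
      refPrice t₁ r p s + if t < s then (x - p t) / s else 0 := by
  split_ifs with h
  · unfold refPrice
    rw [Finset.sum_update_of_mem (Finset.mem_Ico.2 ⟨ht, h⟩),
      ← Finset.sum_sdiff (Finset.singleton_subset_iff.2 (Finset.mem_Ico.2 ⟨ht, h⟩)) (f := p),
      Finset.sum_singleton]
    ring
  · rw [add_zero]
    exact refPrice_congr fun u _ hu => Function.update_of_ne (by omega) _ _

/-- As a function of the price `x` of round `t` alone, the revenue is a parabola with leading
coefficient `-1/2` and vertex `bestResponse`, which does not involve `p t`. The price acts on its
own round and, through the reference price, on each later round `s` with weight `1 / s`. -/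
theorem normalizedRevenue_update (C₁ C₂ : ℝ) {T t₁ : ℕ} (r : ℝ) (p : ℕ → ℝ) {t : ℕ}
    (ht : t ∈ Icc t₁ T) (x : ℝ) :
    normalizedRevenue C₁ C₂ T t₁ r (Function.update p t x) - normalizedRevenue C₁ C₂ T t₁ r p =
      (x - p t) * (bestResponse C₁ C₂ T t₁ r p t - (x + p t) / 2) := by
  have ht' := Finset.mem_Icc.1 ht
  have hsub : Ioc t T ⊆ Icc t₁ T := fun s hs => by
    rw [Finset.mem_Ioc] at hs; rw [Finset.mem_Icc]; omega
  have key : ∀ s ∈ Icc t₁ T,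
      Function.update p t x s *
          (C₂ - Function.update p t x s / 2 + C₁ * refPrice t₁ r (Function.update p t x) s)
        - p s * (C₂ - p s / 2 + C₁ * refPrice t₁ r p s) =
      (if s = t then (x - p t) * (C₂ + C₁ * refPrice t₁ r p t - (x + p t) / 2) else 0)
        + if s ∈ Ioc t T then (x - p t) * (C₁ * (p s / s)) else 0 := by
    intro s hs
    have hs' := Finset.mem_Icc.1 hs
    rw [refPrice_update r p ht'.1]
    rcases lt_trichotomy s t with h | rfl | h
    · rw [Function.update_of_ne h.ne, if_neg (by omega), if_neg h.ne,
        if_neg (by rw [Finset.mem_Ioc]; omega)]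
      ring
    · rw [Function.update_self, if_neg (by omega), if_pos rfl,
        if_neg (by rw [Finset.mem_Ioc]; omega)]
      ring
    · rw [Function.update_of_ne h.ne', if_pos h, if_neg h.ne',
        if_pos (Finset.mem_Ioc.2 ⟨h, hs'.2⟩)]
      ring
  unfold normalizedRevenue bestResponse
  rw [← Finset.sum_sub_distrib, Finset.sum_congr rfl key, Finset.sum_add_distrib,
    Finset.sum_ite_eq' , if_pos ht, ← Finset.sum_filter, Finset.filter_mem_eq_inter,
    Finset.inter_eq_right.2 hsub, ← Finset.mul_sum, ← Finset.mul_sum]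
  ring

theorem exists_isMaxOn_normalizedRevenue (C₁ C₂ : ℝ) {pbar : ℝ} (hpb : 0 ≤ pbar) (T t₁ : ℕ)
    (r : ℝ) : ∃ p ∈ priceBox pbar, ∀ q ∈ feasiblePrices pbar T t₁,
      normalizedRevenue C₁ C₂ T t₁ r q ≤ normalizedRevenue C₁ C₂ T t₁ r p := by
  have hc : Continuous (normalizedRevenue C₁ C₂ T t₁ r) := by
    have h := continuous_refPrice t₁ r
    unfold normalizedRevenue
    fun_prop
  obtain ⟨p, hp, hmax⟩ := (isCompact_priceBox pbar).exists_isMaxOn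
    ⟨fun _ => 0, fun _ _ => ⟨le_rfl, hpb⟩⟩ hc.continuousOn
  refine ⟨p, hp, fun q hq => ?_⟩
  obtain ⟨q', hq', he⟩ := exists_mem_priceBox_eqOn hpb hq
  have : normalizedRevenue C₁ C₂ T t₁ r q = normalizedRevenue C₁ C₂ T t₁ r q' := by
    refine Finset.sum_congr rfl fun t ht => ?_
    rw [he t ht, refPrice_congr fun s hs hst =>
      he s (Finset.mem_Icc.2 ⟨hs, hst.le.trans (Finset.mem_Icc.1 ht).2⟩)]
  rw [this]
  exact hmax hq'

/-- A maximizer plays in each round the best response, truncated at `pbar`. -/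
theorem eq_min_bestResponse {C₁ C₂ pbar : ℝ} (hC₁ : 0 ≤ C₁) (hC₂ : 0 ≤ C₂) {T t₁ : ℕ}
    (h₁ : 1 ≤ t₁) {r : ℝ} (hr : r ∈ Set.Icc 0 pbar) {p : ℕ → ℝ} (hp : p ∈ priceBox pbar)
    (hmax : ∀ q ∈ feasiblePrices pbar T t₁,
      normalizedRevenue C₁ C₂ T t₁ r q ≤ normalizedRevenue C₁ C₂ T t₁ r p)
    {t : ℕ} (ht : t ∈ Icc t₁ T) : p t = min pbar (bestResponse C₁ C₂ T t₁ r p t) := by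
  have hrt := refPrice_mem h₁ hr (priceBox_subset pbar T t₁ hp) ht
  have hpt := hp t trivial
  have hpb : 0 ≤ pbar := hr.1.trans hr.2
  have hq0 : 0 ≤ bestResponse C₁ C₂ T t₁ r p t :=
    add_nonneg hC₂ (mul_nonneg hC₁ (add_nonneg hrt.1
      (Finset.sum_nonneg fun s _ => div_nonneg (hp s trivial).1 (Nat.cast_nonneg _))))
  set q := bestResponse C₁ C₂ T t₁ r p t with hq
  have hle := hmax (Function.update p t (min pbar q)) (fun s _ => by
    rcases eq_or_ne s t with rfl | h
    · rw [Function.update_self]; exact ⟨le_min hpb hq0, min_le_left _ _⟩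
    · rw [Function.update_of_ne h]; exact hp s trivial)
  have hupd := normalizedRevenue_update C₁ C₂ r p ht (min pbar q)
  rw [← hq] at hupd
  rcases le_total q pbar with h | h
  · rw [min_eq_right h] at hle hupd ⊢
    -- Moving to the vertex gains `(q - p t) ^ 2 / 2`, which by maximality is not positive.
    nlinarith [sq_nonneg (q - p t)]
  · rw [min_eq_left h] at hle hupd ⊢
    by_contra hne
    have hlt : p t < pbar := lt_of_le_of_ne hpt.2 hne
    nlinarith [mul_pos (sub_pos.2 hlt) (sub_pos.2 (show (pbar + p t) / 2 < q by linarith))]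

/-- The sums over later rounds differ in the single term `p (t + 1) / (t + 1)`, and the running
average moves by `(p t - r t) / (t + 1)`, where `r t` is the reference price. Hence the whole future
cancels and a one-step recursion remains. -/
theorem bestResponse_succ (C₁ C₂ : ℝ) {T t₁ : ℕ} (h₁ : 1 ≤ t₁) (r : ℝ) (p : ℕ → ℝ) {t : ℕ}
    (h : t₁ ≤ t) (hT : t < T) :
    ((t : ℝ) + 1) *
        (bestResponse C₁ C₂ T t₁ r p (t + 1) - bestResponse C₁ C₂ T t₁ r p t) =
      C₁ * (p t - refPrice t₁ r p t - p (t + 1)) := by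
  have hs : ∑ s ∈ Ioc t T, p s / s = p (t + 1) / (t + 1) + ∑ s ∈ Ioc (t + 1) T, p s / s := by
    rw [← Finset.insert_Ioc_add_one_left_eq_Ioc hT, Finset.sum_insert (by simp)]
    push_cast
    rfl
  have ht : (t : ℝ) + 1 ≠ 0 := by positivity
  unfold bestResponse
  rw [refPrice_succ t₁ r p t h₁ h, hs]
  field_simp
  ring

/-- A maximizer is nonincreasing. -/
theorem maximizer_succ_le {C₁ C₂ pbar : ℝ} (hC₁ : 0 ≤ C₁) {T t₁ : ℕ}
    (h₁ : 1 ≤ t₁) {r : ℝ} (hr : r ∈ Set.Icc 0 pbar) {p : ℕ → ℝ} (hp : p ∈ priceBox pbar)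
    (hmin : ∀ t ∈ Icc t₁ T, p t = min pbar (bestResponse C₁ C₂ T t₁ r p t))
    {t : ℕ} (h : t₁ ≤ t) (hT : t < T) : p (t + 1) ≤ p t := by
  have m1 := hmin t (Finset.mem_Icc.2 ⟨h, hT.le⟩)
  have m2 := hmin (t + 1) (Finset.mem_Icc.2 ⟨by omega, hT⟩)
  have hrt := refPrice_mem h₁ hr (priceBox_subset pbar T t₁ hp) (Finset.mem_Icc.2 ⟨h, hT.le⟩)
  have hs := bestResponse_succ C₁ C₂ h₁ r p h hT
  by_contra! hlt
  have ht : (0 : ℝ) < (t : ℝ) + 1 := by positivity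
  have hle : bestResponse C₁ C₂ T t₁ r p (t + 1) ≤ bestResponse C₁ C₂ T t₁ r p t := by
    have : C₁ * (p t - refPrice t₁ r p t - p (t + 1)) ≤ 0 :=
      mul_nonpos_of_nonneg_of_nonpos hC₁ (by linarith [hrt.1])
    by_contra! hc
    nlinarith [mul_pos ht (sub_pos.2 hc)]
  exact absurd (min_le_min_left pbar hle) (by rw [← m1, ← m2]; exact not_le.2 hlt)

/-- Some policy curve is a nonincreasing maximizer of the normalized symmetric revenue. -/
theorem exists_policyCurve_isMaxOn {C₁ C₂ pbar : ℝ} (hC₁ : 0 ≤ C₁) (hC₂ : 0 ≤ C₂)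
    (hC : C₁ * pbar + C₂ ≤ pbar) {T t₁ : ℕ} (h₁ : 1 ≤ t₁) (hT : t₁ ≤ T) {r : ℝ}
    (hr : r ∈ Set.Icc 0 pbar) :
    ∃ (tD : ℕ) (pD : ℝ), tD ∈ Set.Icc t₁ T ∧ pD ∈ Set.Icc 0 pbar ∧
      policyCurve C₁ C₂ pbar T t₁ r tD pD ∈ feasiblePrices pbar T t₁ ∧
      policyCurve C₁ C₂ pbar T t₁ r tD pD T =
        C₁ * refPrice t₁ r (policyCurve C₁ C₂ pbar T t₁ r tD pD) T + C₂ ∧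
      (∀ t, t₁ ≤ t → t < T → policyCurve C₁ C₂ pbar T t₁ r tD pD (t + 1) ≤
        policyCurve C₁ C₂ pbar T t₁ r tD pD t) ∧
      ∀ q ∈ feasiblePrices pbar T t₁, normalizedRevenue C₁ C₂ T t₁ r q ≤
        normalizedRevenue C₁ C₂ T t₁ r (policyCurve C₁ C₂ pbar T t₁ r tD pD) := by
  obtain ⟨p, hp, hmax⟩ := exists_isMaxOn_normalizedRevenue C₁ C₂ (hr.1.trans hr.2) T t₁ r
  have hmin : ∀ t ∈ Icc t₁ T, p t = min pbar (bestResponse C₁ C₂ T t₁ r p t) :=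
    fun t ht => eq_min_bestResponse hC₁ hC₂ h₁ hr hp hmax ht
  have hTm : T ∈ Icc t₁ T := Finset.mem_Icc.2 ⟨hT, le_rfl⟩
  have hqT : bestResponse C₁ C₂ T t₁ r p T = C₁ * refPrice t₁ r p T + C₂ := by
    simp [bestResponse, add_comm]
  have hqT' : bestResponse C₁ C₂ T t₁ r p T ≤ pbar := by
    have := mul_le_mul_of_nonneg_left
      (refPrice_mem h₁ hr (priceBox_subset pbar T t₁ hp) hTm).2 hC₁
    linarith
  have hex : ∃ t, t₁ ≤ t ∧ bestResponse C₁ C₂ T t₁ r p t ≤ pbar := ⟨T, hT, hqT'⟩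
  classical
  -- The switching time is the first round in which truncation at `pbar` is not needed.
  obtain ⟨tD, ⟨htD, hqD⟩, hfirst⟩ : ∃ t, (t₁ ≤ t ∧ bestResponse C₁ C₂ T t₁ r p t ≤ pbar) ∧
      ∀ s < t, ¬ (t₁ ≤ s ∧ bestResponse C₁ C₂ T t₁ r p s ≤ pbar) :=
    ⟨Nat.find hex, Nat.find_spec hex, fun s hs => Nat.find_min hex hs⟩
  have htDT : tD ≤ T := by
    by_contra! h
    exact hfirst T h ⟨hT, hqT'⟩
  have hbelow : ∀ t, tD ≤ t → t ≤ T → bestResponse C₁ C₂ T t₁ r p t ≤ pbar := by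
    intro t ht
    induction t, ht using Nat.le_induction with
    | base => exact fun _ => hqD
    | succ t ht ih =>
      intro htT
      have ih := ih (by omega)
      have m2 := hmin (t + 1) (Finset.mem_Icc.2 ⟨by omega, htT⟩)
      -- If the best response rose above `pbar` again, the price would be `pbar ≥ p t` in round `t +
      -- 1`, and `bestResponse_succ` would make the best response decrease.
      by_contra! hc
      rw [min_eq_left hc.le] at m2
      have hpt := (hp t trivial).2
      have hrt := refPrice_mem h₁ hr (priceBox_subset pbar T t₁ hp)
        (Finset.mem_Icc.2 ⟨htD.trans ht, by omega⟩ : t ∈ Icc t₁ T)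
      have hs := bestResponse_succ C₁ C₂ h₁ r p (htD.trans ht) (show t < T by omega)
      have hn : C₁ * (p t - refPrice t₁ r p t - p (t + 1)) ≤ 0 :=
        mul_nonpos_of_nonneg_of_nonpos hC₁ (by linarith [hrt.1])
      have ht0 : (0 : ℝ) < (t : ℝ) + 1 := by positivity
      nlinarith [mul_pos ht0 (sub_pos.2 (lt_of_le_of_lt ih hc))]
  have hfoc : ∀ t, tD ≤ t → t ≤ T → p t = bestResponse C₁ C₂ T t₁ r p t := fun t ht htT => by
    rw [hmin t (Finset.mem_Icc.2 ⟨htD.trans ht, htT⟩)]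
    exact min_eq_right (hbelow t ht htT)
  have hcurve : ∀ t, t₁ ≤ t → t ≤ T → policyCurve C₁ C₂ pbar T t₁ r tD (p tD) t = p t := by
    intro t
    induction t using Nat.strong_induction_on with
    | _ t ih =>
      intro ht htT
      have href : ∀ u ≤ t, refPrice t₁ r (policyCurve C₁ C₂ pbar T t₁ r tD (p tD)) u =
          refPrice t₁ r p u := fun u hu =>
        refPrice_congr fun s hs hst => ih s (by omega) hs (by omega)
      rw [policyCurve, markdownCurve_eq]
      change (if t < tD then pbar else if t = tD then p tD else if t < T then
        policyCurve C₁ C₂ pbar T t₁ r tD (p tD) (t - 1) - C₁ * refPrice t₁ r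
          (policyCurve C₁ C₂ pbar T t₁ r tD (p tD)) (t - 1) / ((t : ℝ) + C₁)
        else C₁ * refPrice t₁ r (policyCurve C₁ C₂ pbar T t₁ r tD (p tD)) t + C₂) = p t
      split_ifs with c1 c2 c3
      · have hgt : pbar < bestResponse C₁ C₂ T t₁ r p t := by
          by_contra! h
          exact hfirst t c1 ⟨ht, h⟩
        rw [hmin t (Finset.mem_Icc.2 ⟨ht, htT⟩), min_eq_left hgt.le]
      · rw [c2]
      · obtain ⟨u, rfl⟩ : ∃ u, t = u + 1 := ⟨t - 1, by omega⟩
        rw [Nat.add_sub_cancel, href u (by omega), ih u (by omega) (by omega) (by omega)]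
        have hs := bestResponse_succ C₁ C₂ h₁ r p (show t₁ ≤ u by omega) (show u < T by omega)
        -- Here `tD ≤ u`, so both best responses are the prices themselves; solving the recursion
        -- for `p (u + 1)` gives the markdown.
        rw [← hfoc u (by omega) (by omega), ← hfoc (u + 1) (by omega) htT] at hs
        have hpos : ((u + 1 : ℕ) : ℝ) + C₁ ≠ 0 := by positivity
        field_simp
        push_cast
        linarith
      · obtain rfl : t = T := by omega
        rw [href t le_rfl, hfoc t (by omega) le_rfl, hqT]
  have hrefT : refPrice t₁ r (policyCurve C₁ C₂ pbar T t₁ r tD (p tD)) T = refPrice t₁ r p T :=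
    refPrice_congr fun s hs hst => hcurve s hs hst.le
  refine ⟨tD, p tD, ⟨htD, htDT⟩, hp tD trivial, fun t ht => ?_, ?_, fun t ht htT => ?_,
    fun q hq => (hmax q hq).trans_eq (Finset.sum_congr rfl fun t ht => ?_)⟩
  · rw [hcurve t (Finset.mem_Icc.1 ht).1 (Finset.mem_Icc.1 ht).2]
    exact hp t trivial
  · rw [hcurve T hT le_rfl, hrefT, hfoc T htDT le_rfl, hqT]
  · rw [hcurve t ht htT.le, hcurve (t + 1) (by omega) htT]
    exact maximizer_succ_le hC₁ h₁ hr hp hmin ht htT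
  · have ht' := Finset.mem_Icc.1 ht
    rw [hcurve t ht'.1 ht'.2, refPrice_congr fun s hs hst => hcurve s hs (hst.le.trans ht'.2)]

/-! ### Sorting a price sequence -/

/-- Charging the higher of two prices `x ≤ y` first does not decrease the revenue of two
consecutive rounds, if the lower one does not exceed the reference price. -/
theorem demand_swap_le {H : ℝ → ℝ} {ηp ηm x y r t : ℝ} (hp : 0 ≤ ηp) (hm : 0 ≤ ηm) (hx : 0 ≤ x)
    (hxy : x ≤ y) (hxr : x ≤ r) (ht : 0 ≤ t) :
    x * demand H ηp ηm x r + y * demand H ηp ηm y ((t * r + x) / (t + 1)) ≤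
      y * demand H ηp ηm y r + x * demand H ηp ηm x ((t * r + y) / (t + 1)) := by
  obtain ⟨k, hk⟩ : ∃ k, k = (t + 1)⁻¹ := ⟨_, rfl⟩
  have ht1 : 0 < t + 1 := by linarith
  have hk0 : 0 ≤ k := by rw [hk]; positivity
  have hk1 : k ≤ 1 := by rw [hk]; exact inv_le_one_of_one_le₀ (by linarith)
  have e1 : (t * r + x) / (t + 1) = r - k * (r - x) := by rw [hk]; field_simp; ring
  have e2 : (t * r + y) / (t + 1) = r + k * (y - r) := by rw [hk]; field_simp; ring
  have hx0 : 0 ≤ r - x := by linarith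
  have hrx : 0 ≤ k * (r - x) := mul_nonneg hk0 hx0
  have hxr' : x ≤ r + k * (y - r) := by
    nlinarith [mul_nonneg hk0 (sub_nonneg.2 hxy), mul_nonneg (sub_nonneg.2 hk1) hx0]
  have hy : 0 ≤ y := hx.trans hxy
  rw [e1, e2]
  unfold demand
  rw [max_eq_left (show 0 ≤ r - x by linarith), max_eq_right (show x - r ≤ 0 by linarith),
    max_eq_left (show 0 ≤ r + k * (y - r) - x by linarith),
    max_eq_right (show x - (r + k * (y - r)) ≤ 0 by linarith)]
  -- The base demands cancel. The cases place `y` relative to `r` and to the lower reference price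
  -- that results from charging `x` first; in each, the difference is a sum of visibly nonnegative
  -- multiples of `ηp` and `ηm`.
  rcases le_total y (r - k * (r - x)) with h | h
  · rw [max_eq_left (show 0 ≤ r - k * (r - x) - y by linarith),
      max_eq_right (show y - (r - k * (r - x)) ≤ 0 by linarith),
      max_eq_left (show 0 ≤ r - y by linarith), max_eq_right (show y - r ≤ 0 by linarith)]
    linarith [mul_nonneg hp (mul_nonneg hk0 (mul_nonneg (hx.trans hxr) (sub_nonneg.2 hxy)))]
  rw [max_eq_right (show r - k * (r - x) - y ≤ 0 by linarith),
    max_eq_left (show 0 ≤ y - (r - k * (r - x)) by linarith)]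
  rcases le_total y r with h' | h'
  · rw [max_eq_left (show 0 ≤ r - y by linarith), max_eq_right (show y - r ≤ 0 by linarith)]
    have hkx : 0 ≤ y - k * x := by nlinarith [mul_nonneg (sub_nonneg.2 hk1) hx]
    linarith [mul_nonneg hp (mul_nonneg (sub_nonneg.2 h') hkx),
      mul_nonneg hm (mul_nonneg hy (sub_nonneg.2 h))]
  · rw [max_eq_right (show r - y ≤ 0 by linarith), max_eq_left (show 0 ≤ y - r by linarith)]
    linarith [mul_nonneg hp (mul_nonneg hx (mul_nonneg hk0 (sub_nonneg.2 h'))),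
      mul_nonneg hm (mul_nonneg hy hrx)]

theorem sum_Icc_sub_of_eq_off_pair {T t₁ t : ℕ} (ht : t₁ ≤ t) (hT : t < T) {f g : ℕ → ℝ}
    (h : ∀ s ∈ Icc t₁ T, s ≠ t → s ≠ t + 1 → f s = g s) :
    ∑ s ∈ Icc t₁ T, f s - ∑ s ∈ Icc t₁ T, g s = f t + f (t + 1) - (g t + g (t + 1)) := by
  have hsub : ({t, t + 1} : Finset ℕ) ⊆ Icc t₁ T := by
    intro s hs
    rw [Finset.mem_insert, Finset.mem_singleton] at hs
    rw [Finset.mem_Icc]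
    omega
  rw [← Finset.sum_sub_distrib, ← Finset.sum_subset hsub, Finset.sum_pair (by omega)]
  · ring
  · intro s hs hs'
    rw [Finset.mem_insert, Finset.mem_singleton, not_or] at hs'
    rw [h s hs hs'.1 hs'.2, sub_self]

/-- Only the reference price of round `t + 1` sees one of the two swapped prices without the other,
so a swap changes the revenue of just two rounds. -/
theorem refPrice_comp_swap {t₁ t : ℕ} (ht : t₁ ≤ t) (r : ℝ) (p : ℕ → ℝ) {s : ℕ}
    (hs : s ≠ t + 1) : refPrice t₁ r (p ∘ Equiv.swap t (t + 1)) s = refPrice t₁ r p s := by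
  rcases Nat.lt_or_ge t s with h | h
  · unfold refPrice
    congr 2
    refine Finset.sum_equiv (Equiv.swap t (t + 1)) (fun i => ?_) fun i _ => rfl
    simp only [Finset.mem_Ico, Equiv.swap_apply_def]
    split_ifs <;> omega
  · refine refPrice_congr fun u _ hu => ?_
    rw [Function.comp_apply, Equiv.swap_apply_of_ne_of_ne (by omega) (by omega)]

/-- The reference price averages `r` and earlier prices, all at least `p t`. -/
theorem le_refPrice {t₁ : ℕ} (h₁ : 1 ≤ t₁) {r : ℝ} {p : ℕ → ℝ} {t : ℕ} (ht : t₁ ≤ t)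
    (hr : p t ≤ r) (hp : ∀ s, t₁ ≤ s → s < t → p (s + 1) ≤ p s) : p t ≤ refPrice t₁ r p t := by
  have hpt : ∀ s, t₁ ≤ s → s ≤ t → p t ≤ p s := fun s hs hst =>
    Nat.decreasingInduction' (P := fun k => p t ≤ p k)
      (fun k hk hk' ih => ih.trans (hp k (hs.trans hk') hk)) hst le_rfl
  have ht0 : (0 : ℝ) < t := by
    have : 0 < t := by omega
    exact_mod_cast this
  have h2 : ∑ _s ∈ Ico t₁ t, p t ≤ ∑ s ∈ Ico t₁ t, p s :=
    Finset.sum_le_sum fun s hs => hpt s (Finset.mem_Ico.1 hs).1 (Finset.mem_Ico.1 hs).2.le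
  rw [Finset.sum_const, Nat.card_Ico, nsmul_eq_mul, Nat.cast_sub ht] at h2
  rw [refPrice, le_div_iff₀ ht0]
  have h3 : (t₁ : ℝ) * p t ≤ t₁ * r := mul_le_mul_of_nonneg_left hr (Nat.cast_nonneg _)
  linarith

/-- Starting from the highest reference price, every price sequence can be replaced by a
nonincreasing one without loss of revenue. -/
theorem exists_antitone_revenue_le {a b ηp ηm pbar : ℝ} (hp : 0 ≤ ηp) (hm : 0 ≤ ηm)
    (hpb : 0 ≤ pbar) {T t₁ : ℕ} (h₁ : 1 ≤ t₁) {p : ℕ → ℝ} (hpf : p ∈ feasiblePrices pbar T t₁) :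
    ∃ q ∈ feasiblePrices pbar T t₁, (∀ t, t₁ ≤ t → t < T → q (t + 1) ≤ q t) ∧
      revenue (linearBase a b) ηp ηm T t₁ pbar p ≤
        revenue (linearBase a b) ηp ηm T t₁ pbar q := by
  obtain ⟨p', hp', he⟩ := exists_mem_priceBox_eqOn hpb hpf
  rw [revenue_congr he]
  have hcl : IsClosed {q | revenue (linearBase a b) ηp ηm T t₁ pbar p' ≤
      revenue (linearBase a b) ηp ηm T t₁ pbar q} :=
    isClosed_le continuous_const (continuous_revenue a b ηp ηm T t₁ pbar)
  -- Among the sequences with at least the revenue of `p'`, take one that minimizes this weighted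
  -- sum. Swapping its first ascent keeps the revenue bound and lowers the sum by `q (t + 1) - q t >
  -- 0`, so there is no ascent.
  have hW : Continuous fun q : ℕ → ℝ => ∑ s ∈ Icc t₁ T, (s : ℝ) * q s := by fun_prop
  obtain ⟨q, ⟨hq, hqr⟩, hmin⟩ := ((isCompact_priceBox pbar).inter_right hcl).exists_isMinOn
    ⟨p', hp', le_refl (revenue (linearBase a b) ηp ηm T t₁ pbar p')⟩ hW.continuousOn
  refine ⟨q, priceBox_subset pbar T t₁ hq, ?_, hqr⟩
  by_contra! hex
  classical
  obtain ⟨t, ⟨ht, hT, hlt⟩, hfirst⟩ : ∃ t, (t₁ ≤ t ∧ t < T ∧ q t < q (t + 1)) ∧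
      ∀ s < t, ¬ (t₁ ≤ s ∧ s < T ∧ q s < q (s + 1)) :=
    ⟨Nat.find hex, Nat.find_spec hex, fun s hs => Nat.find_min hex hs⟩
  -- As the ascent is the first one, the prices before it are nonincreasing; this gives the
  -- hypothesis of `demand_swap_le`.
  have href : q t ≤ refPrice t₁ pbar q t :=
    le_refPrice h₁ ht (hq t trivial).2 fun s hs hst => by
      by_contra! h
      exact hfirst s hst ⟨hs, by omega, h⟩
  set q' := q ∘ Equiv.swap t (t + 1) with hq'
  have hq't : q' t = q (t + 1) := by simp [hq']
  have hq't' : q' (t + 1) = q t := by simp [hq']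
  have hoff : ∀ s, s ≠ t → s ≠ t + 1 → q' s = q s := fun s h h' => by
    rw [hq', Function.comp_apply, Equiv.swap_apply_of_ne_of_ne h h']
  have hrev : revenue (linearBase a b) ηp ηm T t₁ pbar q ≤
      revenue (linearBase a b) ηp ηm T t₁ pbar q' := by
    rw [← sub_nonneg]
    unfold revenue
    rw [sum_Icc_sub_of_eq_off_pair ht hT]
    · rw [hq't, hq't', refPrice_succ t₁ pbar q' t h₁ ht, refPrice_succ t₁ pbar q t h₁ ht, hq't,
        refPrice_comp_swap ht _ _ (by omega), sub_nonneg]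
      exact demand_swap_le hp hm (hq t trivial).1 hlt.le href (Nat.cast_nonneg _)
    · intro s _ h h'
      rw [hoff s h h', refPrice_comp_swap ht _ _ h']
  have hle := hmin (show q' ∈ _ from ⟨fun s _ => hq _ trivial, le_trans hqr hrev⟩)
  simp only [Set.mem_ofPred_eq] at hle
  have hsum := sum_Icc_sub_of_eq_off_pair (f := fun s => (s : ℝ) * q' s)
    (g := fun s => (s : ℝ) * q s) ht hT fun s _ h h' => by rw [hoff s h h']
  simp only [hq't, hq't'] at hsum
  push_cast at hsum
  linarith

/-- Starting from the highest reference price, a nonincreasing price sequence never incurs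
losses. -/
theorem revenue_eq_of_antitone (H : ℝ → ℝ) (ηp ηm ηm' : ℝ) {pbar : ℝ} {T t₁ : ℕ} (h₁ : 1 ≤ t₁)
    {p : ℕ → ℝ} (hp : p ∈ feasiblePrices pbar T t₁)
    (hanti : ∀ t, t₁ ≤ t → t < T → p (t + 1) ≤ p t) :
    revenue H ηp ηm T t₁ pbar p = revenue H ηp ηm' T t₁ pbar p := by
  refine Finset.sum_congr rfl fun t ht => ?_
  have ht' := Finset.mem_Icc.1 ht
  have := le_refPrice h₁ ht'.1 (hp t ht).2 fun s hs hst => hanti s hs (by omega)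
  unfold demand
  rw [max_eq_right (show p t - refPrice t₁ pbar p t ≤ 0 by linarith)]
  ring

/-! ### Dependence on the starting reference price -/

theorem refPrice_sub_refPrice (t₁ : ℕ) (r r' : ℝ) (p : ℕ → ℝ) (t : ℕ) :
    refPrice t₁ r' p t - refPrice t₁ r p t = t₁ * (r' - r) / t := by
  unfold refPrice
  ring

theorem demand_mono {H : ℝ → ℝ} {ηp ηm p r r' : ℝ} (hp : 0 ≤ ηp) (hm : 0 ≤ ηm) (h : r ≤ r') :
    demand H ηp ηm p r ≤ demand H ηp ηm p r' := by
  unfold demand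
  gcongr

theorem demand_sub_demand_le {H : ℝ → ℝ} {ηp ηm p r r' : ℝ} (hp : 0 ≤ ηp) (hm : 0 ≤ ηm)
    (h : r ≤ r') : demand H ηp ηm p r' - demand H ηp ηm p r ≤ (ηp + ηm) * (r' - r) := by
  have h1 : max (r' - p) 0 - max (r - p) 0 ≤ r' - r := by
    rw [sub_le_iff_le_add]
    exact max_le (by linarith [le_max_left (r - p) 0])
      (by linarith [le_max_right (r - p) 0])
  have h2 : max (p - r) 0 - max (p - r') 0 ≤ r' - r := by
    rw [sub_le_iff_le_add]
    exact max_le (by linarith [le_max_left (p - r') 0])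
      (by linarith [le_max_right (p - r') 0])
  unfold demand
  linarith [mul_le_mul_of_nonneg_left h1 hp, mul_le_mul_of_nonneg_left h2 hm]

theorem revenue_mono {H : ℝ → ℝ} {ηp ηm pbar : ℝ} (hp : 0 ≤ ηp) (hm : 0 ≤ ηm) {T t₁ : ℕ}
    {r r' : ℝ} (h : r ≤ r') {p : ℕ → ℝ} (hpf : p ∈ feasiblePrices pbar T t₁) :
    revenue H ηp ηm T t₁ r p ≤ revenue H ηp ηm T t₁ r' p := by
  refine Finset.sum_le_sum fun t ht => mul_le_mul_of_nonneg_left (demand_mono hp hm ?_) (hpf t ht).1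
  rw [← sub_nonneg, refPrice_sub_refPrice]
  exact div_nonneg (mul_nonneg (Nat.cast_nonneg _) (sub_nonneg.2 h)) (Nat.cast_nonneg _)

/-- Each new term obeys `1 / (T + 1) ≤ log ((T + 1) / T)`, by `1 - 1 / x ≤ log x`. -/
theorem sum_inv_Icc_le {T t₁ : ℕ} (h₁ : 1 ≤ t₁) (hT : t₁ ≤ T) :
    ∑ t ∈ Icc t₁ T, (t : ℝ)⁻¹ ≤ (t₁ : ℝ)⁻¹ + Real.log (T / t₁) := by
  have ht₁ : (0 : ℝ) < t₁ := by exact_mod_cast h₁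
  induction T, hT using Nat.le_induction with
  | base => simp [ht₁.ne']
  | succ T hT ih =>
    have hT0 : (0 : ℝ) < T := ht₁.trans_le (by exact_mod_cast hT)
    have hlog := Real.one_sub_inv_le_log_of_pos (show (0 : ℝ) < ((T : ℝ) + 1) / T by positivity)
    have e : (1 : ℝ) - (((T : ℝ) + 1) / T)⁻¹ = ((T : ℝ) + 1)⁻¹ := by field_simp; ring
    rw [e, Real.log_div (by positivity) hT0.ne'] at hlog
    rw [Real.log_div hT0.ne' ht₁.ne'] at ih
    rw [Finset.sum_Icc_succ_top (by omega), Nat.cast_add_one,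
      Real.log_div (by positivity) ht₁.ne']
    linarith

/-- The sum bound leaves `1 + t₁ log (T / t₁)`. For `t₁ < T` the `1` is absorbed, since `t₁ log (T /
t₁) ≥ t₁ (1 - t₁ / T) ≥ t₁ / (t₁ + 1) ≥ 1 / 2`. This is the source of the constant `3`. -/
theorem mul_sum_inv_Icc_le {T t₁ : ℕ} (h₁ : 1 ≤ t₁) (hT : t₁ < T) :
    t₁ * ∑ t ∈ Icc t₁ T, (t : ℝ)⁻¹ ≤ 3 * (t₁ * Real.log (T / t₁)) := by
  have ht₁ : (1 : ℝ) ≤ t₁ := by exact_mod_cast h₁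
  have hT' : (t₁ : ℝ) + 1 ≤ T := by exact_mod_cast hT
  have hs := mul_le_mul_of_nonneg_left (sum_inv_Icc_le h₁ hT.le) (zero_le_one.trans ht₁)
  rw [mul_add, mul_inv_cancel₀ (by positivity)] at hs
  have hlog := Real.one_sub_inv_le_log_of_pos
    (show (0 : ℝ) < (T : ℝ) / t₁ from div_pos (by linarith) (by linarith))
  rw [inv_div] at hlog
  have h2 : (t₁ : ℝ) / T ≤ t₁ / (t₁ + 1) := by gcongr
  have h3 : (1 : ℝ) / 2 ≤ t₁ * (1 - t₁ / (t₁ + 1)) := by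
    have : (t₁ : ℝ) * (1 - t₁ / (t₁ + 1)) = t₁ / (t₁ + 1) := by field_simp; ring
    rw [this, div_le_div_iff₀ (by norm_num) (by linarith)]
    linarith
  have h4 : (t₁ : ℝ) * (1 - t₁ / (t₁ + 1)) ≤ t₁ * Real.log (T / t₁) :=
    mul_le_mul_of_nonneg_left (by linarith) (by linarith)
  linarith

theorem revenue_sub_revenue_le {H : ℝ → ℝ} {ηp ηm pbar : ℝ} (hp : 0 ≤ ηp) (hm : 0 ≤ ηm)
    (hpb : 0 ≤ pbar) {T t₁ : ℕ} (h₁ : 1 ≤ t₁) (hT : t₁ < T) {r r' : ℝ} (h : r ≤ r') {p : ℕ → ℝ}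
    (hpf : p ∈ feasiblePrices pbar T t₁) :
    revenue H ηp ηm T t₁ r' p - revenue H ηp ηm T t₁ r p ≤
      3 * (pbar * (r' - r) * (ηp + ηm)) * (t₁ * Real.log (T / t₁)) := by
  have hc : 0 ≤ pbar * (r' - r) * (ηp + ηm) :=
    mul_nonneg (mul_nonneg hpb (sub_nonneg.2 h)) (add_nonneg hp hm)
  calc revenue H ηp ηm T t₁ r' p - revenue H ηp ηm T t₁ r p
      ≤ ∑ t ∈ Icc t₁ T, pbar * (r' - r) * (ηp + ηm) * (t₁ * (t : ℝ)⁻¹) := by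
        unfold revenue
        rw [← Finset.sum_sub_distrib]
        refine Finset.sum_le_sum fun t ht => ?_
        have hd := refPrice_sub_refPrice t₁ r r' p t
        have h0 : 0 ≤ (t₁ : ℝ) * (r' - r) / t :=
          div_nonneg (mul_nonneg (Nat.cast_nonneg _) (sub_nonneg.2 h)) (Nat.cast_nonneg _)
        have hD := demand_sub_demand_le (H := H) (p := p t) hp hm
          (show refPrice t₁ r p t ≤ refPrice t₁ r' p t by linarith)
        rw [hd] at hD
        rw [← mul_sub]
        calc _ ≤ p t * ((ηp + ηm) * (t₁ * (r' - r) / t)) :=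
              mul_le_mul_of_nonneg_left hD (hpf t ht).1
          _ ≤ pbar * ((ηp + ηm) * (t₁ * (r' - r) / t)) :=
              mul_le_mul_of_nonneg_right (hpf t ht).2 (mul_nonneg (add_nonneg hp hm) h0)
          _ = _ := by ring
    _ = pbar * (r' - r) * (ηp + ηm) * (t₁ * ∑ t ∈ Icc t₁ T, (t : ℝ)⁻¹) := by
        rw [Finset.mul_sum, Finset.mul_sum]
    _ ≤ pbar * (r' - r) * (ηp + ηm) * (3 * (t₁ * Real.log (T / t₁))) :=
        mul_le_mul_of_nonneg_left (mul_sum_inv_Icc_le h₁ hT) hc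
    _ = _ := by ring

/-! ### The policy curves of an instance -/

namespace IsInstance

variable {pbar a b ηp ηm : ℝ}

/-- The last bound amounts to `b ≤ (2 a + ηp) pbar`, which follows from `b / (2 a) < pbar`. It
ensures that the last price needs no truncation. -/
theorem policy_bounds (hI : IsInstance pbar a b ηp ηm) :
    0 ≤ ηp / (2 * (a + ηp)) ∧ 0 ≤ b / (2 * (a + ηp)) ∧
      ηp / (2 * (a + ηp)) * pbar + b / (2 * (a + ηp)) ≤ pbar := by
  have ha := hI.a_pos
  have hη := hI.gain_nonneg
  have hb : 0 < b := (div_pos_iff_of_pos_right (by linarith)).1 hI.maximizer_pos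
  have hlt := (div_lt_iff₀ (by linarith)).1 hI.maximizer_lt
  have hpb : 0 < pbar := hI.maximizer_pos.trans hI.maximizer_lt
  refine ⟨by positivity, by positivity, ?_⟩
  rw [div_mul_eq_mul_div, ← add_div, div_le_iff₀ (by linarith)]
  nlinarith [mul_nonneg hη hpb.le]

theorem revenue_le_optRevenue (hI : IsInstance pbar a b ηp ηm) {T t₁ : ℕ} (h₁ : 1 ≤ t₁) {r : ℝ}
    (hr : r ∈ Set.Icc 0 pbar) {p : ℕ → ℝ} (hp : p ∈ feasiblePrices pbar T t₁) :
    revenue (linearBase a b) ηp ηm T t₁ r p ≤ optRevenue (linearBase a b) ηp ηm pbar T t₁ r :=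
  le_csSup (bddAbove_revenue hI h₁ hr) ⟨p, hp, rfl⟩

theorem optRevenue_le {T t₁ : ℕ} {r c : ℝ} {H : ℝ → ℝ} (hpb : 0 ≤ pbar)
    (h : ∀ p ∈ feasiblePrices pbar T t₁, revenue H ηp ηm T t₁ r p ≤ c) :
    optRevenue H ηp ηm pbar T t₁ r ≤ c := by
  refine csSup_le ⟨_, fun _ => 0, fun _ _ => ⟨le_rfl, hpb⟩, rfl⟩ ?_
  rintro _ ⟨p, hp, rfl⟩
  exact h p hp

/-- A maximizer of the normalized revenue is optimal for symmetric reference effects. -/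
theorem optRevenue_eq_of_symm {η : ℝ} (hI : IsInstance pbar a b η η) {T t₁ : ℕ} (h₁ : 1 ≤ t₁)
    {r : ℝ} (hr : r ∈ Set.Icc 0 pbar) {c : ℕ → ℝ} (hc : c ∈ feasiblePrices pbar T t₁)
    (hmax : ∀ q ∈ feasiblePrices pbar T t₁,
      normalizedRevenue (η / (2 * (a + η))) (b / (2 * (a + η))) T t₁ r q ≤
        normalizedRevenue (η / (2 * (a + η))) (b / (2 * (a + η))) T t₁ r c) :
    optRevenue (linearBase a b) η η pbar T t₁ r = revenue (linearBase a b) η η T t₁ r c := by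
  have hpos : 0 < a + η := by linarith [hI.a_pos, hI.gain_nonneg]
  refine le_antisymm (optRevenue_le (hr.1.trans hr.2) fun p hp => ?_)
    (hI.revenue_le_optRevenue h₁ hr hc)
  rw [revenue_symm b hpos, revenue_symm b hpos]
  exact mul_le_mul_of_nonneg_left (hmax p hp) (by linarith)

/-- Regret bound for a nonincreasing curve that maximizes the normalized revenue from the highest
reference price. -/
theorem optRevenue_sub_revenue_le (hI : IsInstance pbar a b ηp ηm) {T t₁ : ℕ} (h₁ : 1 ≤ t₁)
    (hT : t₁ < T) {r : ℝ} (hr : r ∈ Set.Icc 0 pbar) {c : ℕ → ℝ}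
    (hc : c ∈ feasiblePrices pbar T t₁) (hanti : ∀ t, t₁ ≤ t → t < T → c (t + 1) ≤ c t)
    (hmax : ∀ q ∈ feasiblePrices pbar T t₁,
      normalizedRevenue (ηp / (2 * (a + ηp))) (b / (2 * (a + ηp))) T t₁ pbar q ≤
        normalizedRevenue (ηp / (2 * (a + ηp))) (b / (2 * (a + ηp))) T t₁ pbar c) :
    optRevenue (linearBase a b) ηp ηm pbar T t₁ r - revenue (linearBase a b) ηp ηm T t₁ r c ≤
      3 * (pbar * (pbar - r) * (ηp + ηm)) * (t₁ * Real.log (T / t₁)) := by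
  have hp := hI.gain_nonneg
  have hm := hI.loss_nonneg
  have hpb : 0 ≤ pbar := hr.1.trans hr.2
  have hpos : 0 < a + ηp := by linarith [hI.a_pos]
  -- Raise the start to `pbar`, sort, replace `ηm` by `ηp`, and apply the optimality of `c` for the
  -- symmetric problem.
  have hopt : optRevenue (linearBase a b) ηp ηm pbar T t₁ r ≤
      revenue (linearBase a b) ηp ηm T t₁ pbar c := by
    refine optRevenue_le hpb fun p hpf => ?_
    obtain ⟨q, hq, hqa, hle⟩ := exists_antitone_revenue_le (a := a) (b := b) hp hm hpb h₁ hpf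
    refine (revenue_mono hp hm hr.2 hpf).trans (hle.trans ?_)
    rw [revenue_eq_of_antitone _ ηp ηm ηp h₁ hq hqa, revenue_eq_of_antitone _ ηp ηm ηp h₁ hc hanti,
      revenue_symm b hpos, revenue_symm b hpos]
    exact mul_le_mul_of_nonneg_left (hmax q hq) (by linarith)
  linarith [revenue_sub_revenue_le (H := linearBase a b) hp hm hpb h₁ hT hr.2 hc]

end IsInstance

/-! ### Matching the two parametrizations, and the main theorem -/

theorem instanceCurve_eq_policyCurve {a b ηp : ℝ} (h : 0 < a + ηp) (pbar : ℝ) (T : ℕ) (r : ℝ)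
    (tDag : ℕ) (pDag : ℝ) :
    instanceCurve a b ηp pbar T r tDag pDag =
      policyCurve (ηp / (2 * (a + ηp))) (b / (2 * (a + ηp))) pbar T 1 r tDag pDag := by
  unfold instanceCurve policyCurve
  congr 1
  · funext t x
    have e : (t : ℝ) + ηp / (2 * (a + ηp)) = (2 * (a + ηp) * t + ηp) / (2 * (a + ηp)) := by
      field_simp
    rw [e, div_mul_eq_mul_div, div_div_div_cancel_right₀ (by linarith)]
  · funext x
    ring

theorem mainTheorem3 :
    ∃ K : ℝ, 0 < K ∧
      -- the original form: starting time 1, switching time and price determined by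
      -- `T, pbar, a, b, ηp, r`
      (∃ (tDag : ℕ → ℝ → ℝ → ℝ → ℝ → ℝ → ℕ) (pDag : ℕ → ℝ → ℝ → ℝ → ℝ → ℝ → ℝ),
        ∀ (T : ℕ) (pbar a b ηp ηm : ℝ), 1 ≤ T → IsInstance pbar a b ηp ηm →
          ∀ curve : ℝ → ℕ → ℝ,
            (∀ r, curve r = instanceCurve a b ηp pbar T r
              (tDag T pbar a b ηp r) (pDag T pbar a b ηp r)) →
            (∀ r ∈ Set.Icc 0 pbar,
              tDag T pbar a b ηp r ∈ Set.Icc 1 T ∧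
              pDag T pbar a b ηp r ∈ Set.Icc 0 pbar ∧
              curve r ∈ feasiblePrices pbar T 1 ∧
              curve r T = (ηp * refPrice 1 r (curve r) T + b) / (2 * (a + ηp))) ∧
            (ηp = ηm → ∀ r ∈ Set.Icc 0 pbar,
              optRevenue (linearBase a b) ηp ηm pbar T 1 r =
                revenue (linearBase a b) ηp ηm T 1 r (curve r)) ∧
            (2 ≤ T → ∀ r ∈ Set.Icc 0 pbar,
              optRevenue (linearBase a b) ηp ηm pbar T 1 r -
                  revenue (linearBase a b) ηp ηm T 1 r (curve pbar) ≤
                K * (pbar * (pbar - r) * (ηp + ηm)) * Real.log T)) ∧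
      -- the generalized form: starting time `t₁`, switching time and price determined by
      -- `T, pbar, C₁, C₂, r, t₁`
      (∃ (tDag : ℕ → ℝ → ℝ → ℝ → ℝ → ℕ → ℕ) (pDag : ℕ → ℝ → ℝ → ℝ → ℝ → ℕ → ℝ),
        ∀ (T t₁ : ℕ) (pbar a b ηp ηm : ℝ), 1 ≤ t₁ → t₁ ≤ T → IsInstance pbar a b ηp ηm →
          ∀ C₁ C₂ : ℝ, C₁ = ηp / (2 * (a + ηp)) → C₂ = b / (2 * (a + ηp)) →
          ∀ curve : ℝ → ℕ → ℝ,
            (∀ r, curve r = policyCurve C₁ C₂ pbar T t₁ r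
              (tDag T pbar C₁ C₂ r t₁) (pDag T pbar C₁ C₂ r t₁)) →
            (∀ r ∈ Set.Icc 0 pbar,
              tDag T pbar C₁ C₂ r t₁ ∈ Set.Icc t₁ T ∧
              pDag T pbar C₁ C₂ r t₁ ∈ Set.Icc 0 pbar ∧
              curve r ∈ feasiblePrices pbar T t₁ ∧
              curve r T = C₁ * refPrice t₁ r (curve r) T + C₂) ∧
            (ηp = ηm → ∀ r ∈ Set.Icc 0 pbar,
              optRevenue (linearBase a b) ηp ηm pbar T t₁ r =
                revenue (linearBase a b) ηp ηm T t₁ r (curve r)) ∧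
            (t₁ < T → ∀ r ∈ Set.Icc 0 pbar,
              optRevenue (linearBase a b) ηp ηm pbar T t₁ r -
                  revenue (linearBase a b) ηp ηm T t₁ r (curve pbar) ≤
                K * (pbar * (pbar - r) * (ηp + ηm)) * (t₁ * Real.log (T / t₁)))) := by
  -- The hypotheses stand behind the existential, so that `choose` yields functions of these six
  -- parameters alone, with value `0` where the hypotheses fail.
  have hex : ∀ (T : ℕ) (pbar C₁ C₂ r : ℝ) (t₁ : ℕ), ∃ (tD : ℕ) (pD : ℝ),
      0 ≤ C₁ → 0 ≤ C₂ → C₁ * pbar + C₂ ≤ pbar → 1 ≤ t₁ → t₁ ≤ T → r ∈ Set.Icc 0 pbar →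
      tD ∈ Set.Icc t₁ T ∧ pD ∈ Set.Icc 0 pbar ∧
      policyCurve C₁ C₂ pbar T t₁ r tD pD ∈ feasiblePrices pbar T t₁ ∧
      policyCurve C₁ C₂ pbar T t₁ r tD pD T =
        C₁ * refPrice t₁ r (policyCurve C₁ C₂ pbar T t₁ r tD pD) T + C₂ ∧
      (∀ t, t₁ ≤ t → t < T → policyCurve C₁ C₂ pbar T t₁ r tD pD (t + 1) ≤
        policyCurve C₁ C₂ pbar T t₁ r tD pD t) ∧
      ∀ q ∈ feasiblePrices pbar T t₁, normalizedRevenue C₁ C₂ T t₁ r q ≤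
        normalizedRevenue C₁ C₂ T t₁ r (policyCurve C₁ C₂ pbar T t₁ r tD pD) := by
    intro T pbar C₁ C₂ r t₁
    by_cases h : 0 ≤ C₁ ∧ 0 ≤ C₂ ∧ C₁ * pbar + C₂ ≤ pbar ∧ 1 ≤ t₁ ∧ t₁ ≤ T ∧ r ∈ Set.Icc 0 pbar
    · obtain ⟨h1, h2, h3, h4, h5, h6⟩ := h
      obtain ⟨tD, pD, hD⟩ := exists_policyCurve_isMaxOn h1 h2 h3 h4 h5 h6
      exact ⟨tD, pD, fun _ _ _ _ _ _ => hD⟩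
    · exact ⟨0, 0, fun h1 h2 h3 h4 h5 h6 => absurd ⟨h1, h2, h3, h4, h5, h6⟩ h⟩
  choose tD pD hD using hex
  have main : ∀ (T t₁ : ℕ) (pbar a b ηp ηm : ℝ), 1 ≤ t₁ → t₁ ≤ T →
      IsInstance pbar a b ηp ηm → ∀ C₁ C₂ : ℝ, C₁ = ηp / (2 * (a + ηp)) →
      C₂ = b / (2 * (a + ηp)) → ∀ curve : ℝ → ℕ → ℝ,
      (∀ r, curve r = policyCurve C₁ C₂ pbar T t₁ r
        (tD T pbar C₁ C₂ r t₁) (pD T pbar C₁ C₂ r t₁)) →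
      (∀ r ∈ Set.Icc 0 pbar,
        tD T pbar C₁ C₂ r t₁ ∈ Set.Icc t₁ T ∧
        pD T pbar C₁ C₂ r t₁ ∈ Set.Icc 0 pbar ∧
        curve r ∈ feasiblePrices pbar T t₁ ∧
        curve r T = C₁ * refPrice t₁ r (curve r) T + C₂) ∧
      (ηp = ηm → ∀ r ∈ Set.Icc 0 pbar,
        optRevenue (linearBase a b) ηp ηm pbar T t₁ r =
          revenue (linearBase a b) ηp ηm T t₁ r (curve r)) ∧
      (t₁ < T → ∀ r ∈ Set.Icc 0 pbar,
        optRevenue (linearBase a b) ηp ηm pbar T t₁ r -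
            revenue (linearBase a b) ηp ηm T t₁ r (curve pbar) ≤
          3 * (pbar * (pbar - r) * (ηp + ηm)) * (t₁ * Real.log (T / t₁))) := by
    intro T t₁ pbar a b ηp ηm h₁ hT hI C₁ C₂ hC₁ hC₂ curve hcurve
    obtain ⟨b1, b2, b3⟩ := hI.policy_bounds
    rw [← hC₁, ← hC₂] at b3
    rw [← hC₁] at b1
    rw [← hC₂] at b2
    have hD' := fun r hr => hD T pbar C₁ C₂ r t₁ b1 b2 b3 h₁ hT hr
    simp only [← hcurve] at hD'
    refine ⟨fun r hr => ?_, ?_, fun hlt r hr => ?_⟩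
    · obtain ⟨h1, h2, h3, h4, -, -⟩ := hD' r hr
      exact ⟨h1, h2, h3, h4⟩
    · rintro rfl r hr
      obtain ⟨-, -, h3, -, -, h6⟩ := hD' r hr
      rw [hC₁, hC₂] at h6
      exact hI.optRevenue_eq_of_symm h₁ hr h3 h6
    · obtain ⟨-, -, h3, -, h5, h6⟩ := hD' pbar ⟨hr.1.trans hr.2, le_rfl⟩
      rw [hC₁, hC₂] at h6
      exact hI.optRevenue_sub_revenue_le h₁ hlt hr h3 h5 h6
  refine ⟨3, by norm_num, ⟨fun T pbar a b ηp r =>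
      tD T pbar (ηp / (2 * (a + ηp))) (b / (2 * (a + ηp))) r 1, fun T pbar a b ηp r =>
      pD T pbar (ηp / (2 * (a + ηp))) (b / (2 * (a + ηp))) r 1, ?_⟩, tD, pD, main⟩
  intro T pbar a b ηp ηm hT hI curve hcurve
  have hpos : 0 < a + ηp := by linarith [hI.a_pos, hI.gain_nonneg]
  obtain ⟨m1, m2, m3⟩ := main T 1 pbar a b ηp ηm le_rfl hT hI _ _ rfl rfl curve fun r => by
    rw [hcurve r, instanceCurve_eq_policyCurve hpos]
  refine ⟨fun r hr => ?_, m2, fun hlt r hr => ?_⟩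
  · obtain ⟨h1, h2, h3, h4⟩ := m1 r hr
    refine ⟨h1, h2, h3, h4.trans ?_⟩
    ring
  · simpa using m3 (by omega) r hr
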